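/- Let $K$ be a field, let $G$ be a finite simple graph with vertex set $V$, let $R=K[x_v : v\in V]$ with its standard grading, and let $I(G)\subseteq R$ be the edge ideal of $G$, generated by the monomials $x_ux_v$ for all edges $\{u,v\}$ of $G$. A graded minimal finite free resolution of $R/I(G)$ is an exact sequence of finitely generated graded free $R$-modules and degree-preserving $R$-linear maps $$0\to F_p\to\dots\to F_1\to F_0=R\to R/I(G)\to 0,\qquad F_i=\bigoplus_{j\in\mathbb Z} R(-j)^{\beta_{i,j}},$$ in which $R\to R/I(G)$ is the quotient map and all entries of the matrices of the maps $F_{i+1}\to F_i$ lie in the ideal $(x_v : v\in V)$; put $F_i=0$ for $i>p$. The numbers $\beta_{i,d}(G):=\beta_{i,d}$ are the graded Betti numbers of $R/I(G)$. Then such a resolution exists, and for every such resolution and every integer $i\ge 1$: 1. $\beta_{i,d}(G)=0$ for all integers $d>2i$; 2. $\beta_{i,2i}(G)$ is the number of induced subgraphs of $G$ consisting of $i$ pairwise disjoint edges. -/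

import Mathlib

/-- A polynomial is homogeneous of the (integer) degree `e`, i.e. it lies in the degree-`e`
component of the standard grading of the polynomial ring, extended by `0` to negative degrees. -/
def IsHomogeneousOfIntDegree {K σ : Type*} [CommRing K] (p : MvPolynomial σ K) (e : ℤ) : Prop :=
  p = 0 ∨ ∃ n : ℕ, (n : ℤ) = e ∧ p.IsHomogeneous n

/-- A graded minimal finite free resolution
`0 → F_p → ⋯ → F_1 → F_0 = R → R/I → 0` of `R/I`, where `R = K[x_v : v ∈ σ]`.
The graded free module `F_i = ⨁ₐ R(-deg i a)` has `rank i` basis elements, the `a`-th one being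
of degree `deg i a`, and `diff i` is the differential `F_{i+1} → F_i`. -/
structure GradedMinimalFreeResolution {K σ : Type*} [Field K]
    (I : Ideal (MvPolynomial σ K)) where
  /-- the number of basis elements of `F_i` -/
  rank : ℕ → ℕ
  /-- the degrees of the basis elements of `F_i` -/
  deg : (i : ℕ) → Fin (rank i) → ℤ
  /-- the differential `F_{i+1} → F_i` -/
  diff : (i : ℕ) → (Fin (rank (i + 1)) → MvPolynomial σ K) →ₗ[MvPolynomial σ K]
    (Fin (rank i) → MvPolynomial σ K)
  /-- `F_0 = R`, with its generator in degree `0` -/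
  rank_zero : rank 0 = 1
  deg_zero : ∀ a, deg 0 a = 0
  /-- the resolution has finite length -/
  finite_length : ∃ p, ∀ i, p < i → rank i = 0
  /-- the differentials preserve degrees -/
  homogeneous : ∀ i a b,
    IsHomogeneousOfIntDegree (diff i (Pi.single b 1) a) (deg (i + 1) b - deg i a)
  /-- minimality: the entries of the differentials lie in the ideal generated by the variables -/
  minimal : ∀ i a b,
    diff i (Pi.single b 1) a ∈ Ideal.span (Set.range (MvPolynomial.X : σ → MvPolynomial σ K))
  /-- exactness at `F_0 = R`: the image of `F_1 → R` is the kernel `I` of `R → R/I`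
  (here `a` ranges over the one-element type `Fin (rank 0)`) -/
  exact_zero : ∀ x, x ∈ LinearMap.range (diff 0) ↔ ∀ a, x a ∈ I
  /-- exactness at `F_{i+1}` -/
  exact_succ : ∀ i, Function.Exact (diff (i + 1)) (diff i)

/-- The `i`-th Betti number of degree `d` read off from a graded minimal free resolution: the
multiplicity of `R(-d)` as a summand in `F_i`. -/
noncomputable def GradedMinimalFreeResolution.betti {K σ : Type*} [Field K] {I : Ideal (MvPolynomial σ K)}
    (F : GradedMinimalFreeResolution I) (i : ℕ) (d : ℤ) : ℕ :=
  (Finset.univ.filter fun a : Fin (F.rank i) => F.deg i a = d).card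

/-- The graph ideal (edge ideal) `I(G)` in the polynomial ring over `K` on the vertices of `G`. -/
noncomputable def SimpleGraph.edgeIdeal (K : Type*) [Field K] {V : Type*} (G : SimpleGraph V) :
    Ideal (MvPolynomial V K) :=
  Ideal.span {m | ∃ u v : V, G.Adj u v ∧ m = MvPolynomial.X u * MvPolynomial.X v}

/-- The induced subgraphs of `G` which consist of `i` pairwise disjoint edges. (That every vertex
of the subgraph has exactly one neighbour in it is `SimpleGraph.Subgraph.IsMatching`.) -/
def SimpleGraph.inducedDisjointEdges {V : Type*} (G : SimpleGraph V) (i : ℕ) : Set G.Subgraph :=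
  {H | H.IsInduced ∧ H.IsMatching ∧ H.edgeSet.ncard = i}

/-!
The Betti numbers of the edge ideal `I` are computed by comparing a minimal resolution `F` with the
Taylor resolution `T`, whose `i`-th module has a basis element for each set `S` of `i` edges, of
degree the number of vertices covered by `S`.

*Comparison.* The identity of `R/I` lifts to degree preserving chain maps between `F` and `T`, and
the two composites are homotopic to the identity (`Comparison.exists_homotopy`). Modulo the
variables the differential of `F` vanishes, so that `F` becomes a retract of `T`
(`IsMinimal.exists_retract`). Hence every degree occurring in `F i` occurs in `T i`, where all
degrees are at most `2 * i` because `i` edges cover at most `2 * i` vertices.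

*The top degree.* The sets of `i` edges of degree `2 * i` are the matchings. Modulo the variables
an entry of the differential of `T` at `(S, insert e S)` survives exactly if `e` lies inside the
vertex set of `S`. Such an `e` exists if and only if the matching `S` is not induced, and then the
boundary of `insert e S` is `± S` alone, because exchanging an edge of `S` for `e` uncovers a vertex
(`eq_of_biUnion_subset_insert_erase`). So precisely the induced matchings survive in homology
(`IsMinimal.card_deg_eq_two_mul`).

*Exactness of the Taylor resolution.* In each multidegree `w` the complex is the chain complex of
the full simplex on the generators dividing the monomial with exponent `w`, and the cone over the
first of these generators is a contracting homotopy (`simplexBoundary_cone`).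

*Existence.* Choosing minimal families of homogeneous generators of the successive syzygy modules
gives a minimal resolution (`exists_minimal_generators`). It has finite length because it is a
retract of the finite Taylor resolution modulo the variables.
-/

open MvPolynomial Matrix

universe u v

/-! ### Homogeneous components with integer degrees -/

section Grading

variable {K σ : Type*} [CommRing K]

theorem isHomogeneousOfIntDegree_iff {p : MvPolynomial σ K} {e : ℤ} :
    IsHomogeneousOfIntDegree p e ↔ ∀ m, coeff m p ≠ 0 → (m.degree : ℤ) = e := by
  constructor
  · rintro (rfl | ⟨n, rfl, h⟩) m hm
    · simp at hm
    · by_contra hne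
      exact hm (h.coeff_eq_zero fun h' => hne (by rw [h']))
  · intro h
    by_cases hp : p = 0
    · exact Or.inl hp
    · obtain ⟨m, hm⟩ := ne_zero_iff.1 hp
      refine Or.inr ⟨m.degree, h m hm, fun d hd => ?_⟩
      have h1 := h m hm
      have h2 := h d hd
      have h3 := DFunLike.congr_fun (Finsupp.degree_eq_weight_one (R := ℕ) (σ := σ)) d
      refine Eq.trans ?_ (h3.symm.trans (by exact_mod_cast h2.trans h1.symm))
      rfl

/-- The homogeneous component of integer degree `e`, which is zero for negative `e`. -/
noncomputable def intComponent (e : ℤ) (p : MvPolynomial σ K) : MvPolynomial σ K :=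
  if 0 ≤ e then homogeneousComponent e.toNat p else 0

open Classical in
theorem coeff_intComponent (e : ℤ) (p : MvPolynomial σ K) (m : σ →₀ ℕ) :
    coeff m (intComponent e p) = if (m.degree : ℤ) = e then coeff m p else 0 := by
  unfold intComponent
  split_ifs with h1 h2 h2
  · rw [coeff_homogeneousComponent, if_pos (by omega)]
  · rw [coeff_homogeneousComponent, if_neg (by omega)]
  · omega
  · simp

theorem isHomogeneousOfIntDegree_intComponent (e : ℤ) (p : MvPolynomial σ K) :
    IsHomogeneousOfIntDegree (intComponent e p) e := by
  classical
  rw [isHomogeneousOfIntDegree_iff]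
  intro m hm
  rw [coeff_intComponent] at hm
  by_contra h
  simp [h] at hm

theorem intComponent_of_isHomogeneous {p : MvPolynomial σ K} {e : ℤ}
    (h : IsHomogeneousOfIntDegree p e) : intComponent e p = p := by
  classical
  ext m
  rw [coeff_intComponent]
  split_ifs with h1
  · rfl
  · by_contra h2
    exact h1 (isHomogeneousOfIntDegree_iff.1 h m (Ne.symm h2))

theorem intComponent_mul {q : MvPolynomial σ K} {f : ℤ} (hq : IsHomogeneousOfIntDegree q f)
    (e : ℤ) (p : MvPolynomial σ K) :
    intComponent e (q * p) = q * intComponent (e - f) p := by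
  classical
  ext m
  rw [coeff_intComponent, coeff_mul, coeff_mul,
    show ∀ x : K, (if (m.degree : ℤ) = e then x else 0) = (if (m.degree : ℤ) = e then 1 else 0) * x
      from fun x => (boole_mul _ x).symm, Finset.mul_sum]
  refine Finset.sum_congr rfl fun x hx => ?_
  rw [Finset.HasAntidiagonal.mem_antidiagonal] at hx
  rw [coeff_intComponent]
  by_cases h0 : coeff x.1 q = 0
  · simp [h0]
  · have h1 := isHomogeneousOfIntDegree_iff.1 hq _ h0
    have h2 : (m.degree : ℤ) = x.1.degree + x.2.degree := by
      rw [← hx, map_add]; push_cast; rfl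
    have h3 : (m.degree : ℤ) = e ↔ (x.2.degree : ℤ) = e - f := by omega
    simp [h3]

theorem intComponent_sum {ι : Type*} (s : Finset ι) (e : ℤ) (p : ι → MvPolynomial σ K) :
    intComponent e (∑ a ∈ s, p a) = ∑ a ∈ s, intComponent e (p a) := by
  classical
  ext m
  simp only [coeff_intComponent, coeff_sum]
  split_ifs <;> simp

theorem intComponent_zero (e : ℤ) : intComponent e (0 : MvPolynomial σ K) = 0 := by
  classical
  ext m
  simp [coeff_intComponent]

theorem IsHomogeneousOfIntDegree.mul {p q : MvPolynomial σ K} {e f : ℤ}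
    (hp : IsHomogeneousOfIntDegree p e) (hq : IsHomogeneousOfIntDegree q f) :
    IsHomogeneousOfIntDegree (p * q) (e + f) := by
  have h : intComponent (e + f) (p * q) = p * q := by
    rw [intComponent_mul hp, add_sub_cancel_left, intComponent_of_isHomogeneous hq]
  rw [← h]
  exact isHomogeneousOfIntDegree_intComponent _ _

theorem IsHomogeneousOfIntDegree.sum {ι : Type*} {s : Finset ι} {p : ι → MvPolynomial σ K} {e : ℤ}
    (hp : ∀ a ∈ s, IsHomogeneousOfIntDegree (p a) e) :
    IsHomogeneousOfIntDegree (∑ a ∈ s, p a) e := by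
  have h : intComponent e (∑ a ∈ s, p a) = ∑ a ∈ s, p a := by
    rw [intComponent_sum]
    exact Finset.sum_congr rfl fun a ha => intComponent_of_isHomogeneous (hp a ha)
  rw [← h]
  exact isHomogeneousOfIntDegree_intComponent _ _

theorem IsHomogeneousOfIntDegree.eq_of_constantCoeff_ne_zero {p : MvPolynomial σ K} {e : ℤ}
    (hp : IsHomogeneousOfIntDegree p e) (h : constantCoeff p ≠ 0) : e = 0 := by
  have := isHomogeneousOfIntDegree_iff.1 hp 0 (by simpa [constantCoeff_eq] using h)
  simpa using this.symm

theorem IsHomogeneousOfIntDegree.eq_C {p : MvPolynomial σ K}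
    (hp : IsHomogeneousOfIntDegree p 0) : p = C (constantCoeff p) := by
  classical
  ext m
  rw [coeff_C]
  split_ifs with h
  · rw [← h, constantCoeff_eq]
  · by_contra h0
    have := isHomogeneousOfIntDegree_iff.1 hp m h0
    have h1 : m.degree = 0 := by exact_mod_cast this
    rw [Finsupp.degree_eq_zero_iff] at h1
    exact h h1.symm

theorem constantCoeff_intComponent_zero (p : MvPolynomial σ K) :
    constantCoeff (intComponent 0 p) = constantCoeff p := by
  classical
  simp [constantCoeff_eq, coeff_intComponent]

theorem mem_span_range_X_iff {p : MvPolynomial σ K} :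
    p ∈ Ideal.span (Set.range (X : σ → MvPolynomial σ K)) ↔ constantCoeff p = 0 := by
  rw [← Set.image_univ, mem_ideal_span_X_image, constantCoeff_eq]
  constructor
  · intro h
    by_contra h0
    obtain ⟨i, -, hi⟩ := h 0 (mem_support_iff.2 h0)
    simp at hi
  · intro h m hm
    by_contra! h1
    have : m = 0 := by ext i; simpa using h1 i (Set.mem_univ i)
    rw [this, mem_support_iff] at hm
    exact hm h

/-- The degree `e` component of an element of the graded free module with a basis element of
degree `deg a` for each `a`. -/
noncomputable def vecComponent {α : Type*} (deg : α → ℤ) (e : ℤ) (v : α → MvPolynomial σ K) :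
    α → MvPolynomial σ K :=
  fun a => intComponent (e - deg a) (v a)

theorem vecComponent_vecComponent {α : Type*} (deg : α → ℤ) (e : ℤ) (v : α → MvPolynomial σ K) :
    vecComponent deg e (vecComponent deg e v) = vecComponent deg e v :=
  funext fun _ => intComponent_of_isHomogeneous (isHomogeneousOfIntDegree_intComponent _ _)

theorem vecComponent_zero {α : Type*} (deg : α → ℤ) (e : ℤ) :
    vecComponent deg e (0 : α → MvPolynomial σ K) = 0 :=
  funext fun _ => intComponent_zero _

/-- An element of a graded free module is the sum of its components. -/
theorem exists_eq_sum_vecComponent {α : Type*} [Finite α] (deg : α → ℤ)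
    (v : α → MvPolynomial σ K) : ∃ s : Finset ℤ, v = ∑ e ∈ s, vecComponent deg e v := by
  classical
  have := Fintype.ofFinite α
  refine ⟨Finset.univ.biUnion fun a => (v a).support.image fun m => (m.degree : ℤ) + deg a, ?_⟩
  funext a
  ext m
  rw [Finset.sum_apply, coeff_sum]
  simp only [vecComponent, coeff_intComponent]
  by_cases h0 : coeff m (v a) = 0
  · simp [h0]
  · rw [Finset.sum_eq_single ((m.degree : ℤ) + deg a)]
    · simp
    · intro b _ hb
      rw [if_neg]
      omega
    · intro h
      exact absurd (Finset.mem_biUnion.2 ⟨a, Finset.mem_univ _,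
        Finset.mem_image.2 ⟨m, mem_support_iff.2 h0, rfl⟩⟩) h

/-- The matrix of a degree preserving map from the graded free module with basis degrees `degα` to
the one with basis degrees `degβ`. -/
def IsHomogeneousMatrix {α β : Type*} (degβ : β → ℤ) (degα : α → ℤ)
    (A : Matrix β α (MvPolynomial σ K)) : Prop :=
  ∀ b a, IsHomogeneousOfIntDegree (A b a) (degα a - degβ b)

variable {α β γ : Type*} {degα : α → ℤ} {degβ : β → ℤ} {degγ : γ → ℤ}

theorem IsHomogeneousMatrix.vecComponent_col {A : Matrix β α (MvPolynomial σ K)}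
    (hA : IsHomogeneousMatrix degβ degα A) (a : α) :
    vecComponent degβ (degα a) (A.col a) = A.col a :=
  funext fun b => intComponent_of_isHomogeneous (hA b a)

theorem IsHomogeneousMatrix.vecComponent_mulVec [Fintype α] {A : Matrix β α (MvPolynomial σ K)}
    (hA : IsHomogeneousMatrix degβ degα A) (e : ℤ) (v : α → MvPolynomial σ K) :
    vecComponent degβ e (A *ᵥ v) = A *ᵥ vecComponent degα e v := by
  funext b
  simp only [vecComponent, mulVec, dotProduct, intComponent_sum]
  refine Finset.sum_congr rfl fun a _ => ?_
  rw [intComponent_mul (hA b a)]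
  congr 2
  ring

theorem IsHomogeneousMatrix.mul [Fintype β] {B : Matrix γ β (MvPolynomial σ K)}
    {A : Matrix β α (MvPolynomial σ K)} (hB : IsHomogeneousMatrix degγ degβ B)
    (hA : IsHomogeneousMatrix degβ degα A) : IsHomogeneousMatrix degγ degα (B * A) := by
  intro c a
  rw [mul_apply]
  refine IsHomogeneousOfIntDegree.sum fun b _ => ?_
  have := (hB c b).mul (hA b a)
  rwa [show degβ b - degγ c + (degα a - degβ b) = degα a - degγ c by ring] at this

theorem IsHomogeneousMatrix.deg_eq {A : Matrix β α (MvPolynomial σ K)}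
    (hA : IsHomogeneousMatrix degβ degα A) {b : β} {a : α}
    (h : A.map constantCoeff b a ≠ 0) : degβ b = degα a := by
  have := (hA b a).eq_of_constantCoeff_ne_zero h
  omega

/-- A matrix whose columns lie in the image of another matrix factors through it. -/
theorem exists_mul_eq_of_forall_col [Fintype β] {D : Matrix γ β (MvPolynomial σ K)}
    {A : Matrix γ α (MvPolynomial σ K)} (h : ∀ a, ∃ w, D *ᵥ w = A.col a) :
    ∃ B : Matrix β α (MvPolynomial σ K), D * B = A := by
  choose w hw using h
  refine ⟨Matrix.of fun b a => w a b, ?_⟩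
  ext1 c a
  exact congrFun (hw a) c

/-- A degree preserving map into the image of another one lifts to a degree preserving map. -/
theorem IsHomogeneousMatrix.exists_lift [Fintype β] {D : Matrix γ β (MvPolynomial σ K)}
    (hD : IsHomogeneousMatrix degγ degβ D) {A : Matrix γ α (MvPolynomial σ K)}
    (hA : IsHomogeneousMatrix degγ degα A) (h : ∀ a, ∃ w, D *ᵥ w = A.col a) :
    ∃ B : Matrix β α (MvPolynomial σ K), IsHomogeneousMatrix degβ degα B ∧ D * B = A := by
  choose w hw using h
  refine ⟨Matrix.of fun b a => vecComponent degβ (degα a) (w a) b,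
    fun b a => isHomogeneousOfIntDegree_intComponent _ _, ?_⟩
  ext1 c a
  have := hD.vecComponent_mulVec (degα a) (w a)
  rw [hw, hA.vecComponent_col] at this
  exact (congrFun this c).symm

end Grading

/-! ### Comparison of graded free resolutions -/

/-- A graded free resolution of `R/I`, given by the matrices of its differentials; it need be
neither minimal nor finite. The basis of the `i`-th module is indexed by `ι i`. -/
structure GradedFreeResolution {K σ : Type*} [Field K] (I : Ideal (MvPolynomial σ K)) where
  /-- the index type of the basis of the `i`-th module -/
  ι : ℕ → Type u
  /-- the bases are finite -/
  fintype : ∀ i, Fintype (ι i)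
  /-- equality of basis elements is decidable -/
  decEq : ∀ i, DecidableEq (ι i)
  /-- the degrees of the basis elements -/
  deg : ∀ i, ι i → ℤ
  /-- the matrix of the differential from the `(i + 1)`-st module to the `i`-th one -/
  d : ∀ i, Matrix (ι i) (ι (i + 1)) (MvPolynomial σ K)
  nonempty_zero : Nonempty (ι 0)
  subsingleton_zero : Subsingleton (ι 0)
  deg_zero : ∀ a, deg 0 a = 0
  homogeneous : ∀ i, IsHomogeneousMatrix (deg i) (deg (i + 1)) (d i)
  exact_zero : ∀ x, (∃ y, d 0 *ᵥ y = x) ↔ ∀ a, x a ∈ I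
  exact_succ : ∀ i x, d i *ᵥ x = 0 ↔ ∃ y, d (i + 1) *ᵥ y = x

/-- Dependent choice along a sequence of types. -/
theorem exists_seq_of_step {X : ℕ → Type*} (Q : ∀ i, X i → Prop) (P : ∀ i, X i → X (i + 1) → Prop)
    (x₀ : X 0) (h₀ : Q 0 x₀) (step : ∀ i x, Q i x → ∃ y, Q (i + 1) y ∧ P i x y) :
    ∃ s : ∀ i, X i, s 0 = x₀ ∧ (∀ i, Q i (s i)) ∧ ∀ i, P i (s i) (s (i + 1)) := by
  choose f hf using step
  let t : ∀ i, {x : X i // Q i x} := fun i =>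
    Nat.rec ⟨x₀, h₀⟩ (fun i x => ⟨f i x.1 x.2, (hf i x.1 x.2).1⟩) i
  exact ⟨fun i => (t i).1, rfl, fun i => (t i).2, fun i => (hf i (t i).1 (t i).2).2⟩

namespace GradedFreeResolution

attribute [instance] GradedFreeResolution.fintype GradedFreeResolution.decEq

variable {K σ : Type*} [Field K] {I : Ideal (MvPolynomial σ K)}

theorem d_mul_d (F : GradedFreeResolution.{u} I) (i : ℕ) : F.d i * F.d (i + 1) = 0 := by
  ext1 a c
  have := congrFun ((F.exact_succ i _).2 ⟨Pi.single c 1, rfl⟩) a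
  rw [mulVec_mulVec, mulVec_single_one] at this
  exact this

/-- A matrix killed by a differential factors through the next differential. -/
theorem exists_factor (F : GradedFreeResolution.{u} I) (i : ℕ) {α : Type*}
    {A : Matrix (F.ι (i + 1)) α (MvPolynomial σ K)} (hA : F.d i * A = 0) :
    ∀ a, ∃ w, F.d (i + 1) *ᵥ w = A.col a := by
  intro a
  refine (F.exact_succ i _).1 (funext fun b => ?_)
  exact congrFun (congrFun hA b) a

/-- A degree preserving chain map between two resolutions of `R/I` lifting the identity of `R/I`,
given by its matrices. In degree zero the only entry of the matrix is `1`. -/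
structure Comparison (F : GradedFreeResolution.{u} I) (T : GradedFreeResolution.{v} I) where
  /-- the matrix of the map between the `i`-th modules -/
  map : ∀ i, Matrix (T.ι i) (F.ι i) (MvPolynomial σ K)
  homogeneous : ∀ i, IsHomogeneousMatrix (T.deg i) (F.deg i) (map i)
  map_zero : map 0 = Matrix.of fun _ _ => 1
  comm : ∀ i, T.d i * map (i + 1) = map i * F.d i

theorem nonempty_comparison (F : GradedFreeResolution.{u} I) (T : GradedFreeResolution.{v} I) :
    Nonempty (Comparison F T) := by
  have key := exists_seq_of_step (X := fun i => Matrix (T.ι i) (F.ι i) (MvPolynomial σ K))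
    (fun i A => IsHomogeneousMatrix (T.deg i) (F.deg i) A ∧
      ∀ a, ∃ w, T.d i *ᵥ w = (A * F.d i).col a)
    (fun i A B => T.d i * B = A * F.d i) (Matrix.of fun _ _ => 1)
  beta_reduce at key
  obtain ⟨s, h0, h1, h2⟩ := key (by
    refine ⟨fun b a => ?_, fun a => ?_⟩
    · rw [T.deg_zero, F.deg_zero]
      exact Or.inr ⟨0, rfl, isHomogeneous_one _ _⟩
    · rw [T.exact_zero]
      intro b
      have hF := (F.exact_zero (F.d 0 *ᵥ Pi.single a 1)).1 ⟨_, rfl⟩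
      rw [col_apply, mul_apply]
      refine Ideal.sum_mem _ fun c _ => ?_
      have := hF c
      rw [mulVec_single_one] at this
      exact Ideal.mul_mem_left _ _ this) (by
    rintro i A ⟨hA, h⟩
    obtain ⟨B, hB, hBA⟩ := (T.homogeneous i).exists_lift (hA.mul (F.homogeneous i)) h
    refine ⟨B, ⟨hB, T.exists_factor i ?_⟩, hBA⟩
    rw [← Matrix.mul_assoc, hBA, Matrix.mul_assoc, F.d_mul_d, Matrix.mul_zero])
  exact ⟨⟨s, fun i => (h1 i).1, h0, h2⟩⟩

/-- Any two chain maps lifting the identity of `R/I` are chain homotopic. The homotopy `H i` goes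
from the `i`-th to the `(i + 1)`-st module, and it vanishes for `i = 0`. -/
theorem Comparison.exists_homotopy {F : GradedFreeResolution.{u} I} {T : GradedFreeResolution.{v} I}
    (A B : Comparison F T) : ∃ H : ∀ i, Matrix (T.ι (i + 1)) (F.ι i) (MvPolynomial σ K),
      ∀ i, A.map (i + 1) - B.map (i + 1) = T.d (i + 1) * H (i + 1) + H i * F.d i := by
  have hC : ∀ i, T.d i * (A.map (i + 1) - B.map (i + 1)) = (A.map i - B.map i) * F.d i := by
    intro i
    rw [Matrix.mul_sub, Matrix.sub_mul, A.comm, B.comm]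
  -- The condition on `H i` says that the difference of the chain maps in degree `i + 1`, corrected
  -- by `H i`, consists of cycles, so that it lifts along the next differential.
  have key := exists_seq_of_step (X := fun i => Matrix (T.ι (i + 1)) (F.ι i) (MvPolynomial σ K))
    (fun i H => T.d i * H * F.d i = (A.map i - B.map i) * F.d i)
    (fun i H H' => A.map (i + 1) - B.map (i + 1) = T.d (i + 1) * H' + H * F.d i) 0
  beta_reduce at key
  obtain ⟨s, -, -, h⟩ := key (by rw [A.map_zero, B.map_zero]; simp) (by
    intro i H hH
    obtain ⟨H', hH'⟩ := exists_mul_eq_of_forall_col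
      (T.exists_factor i (A := A.map (i + 1) - B.map (i + 1) - H * F.d i)
        (by rw [Matrix.mul_sub, hC, ← Matrix.mul_assoc, hH, sub_self]))
    refine ⟨H', ?_, ?_⟩
    · rw [hH', Matrix.sub_mul, Matrix.mul_assoc H, F.d_mul_d, Matrix.mul_zero, sub_zero]
    · rw [hH', sub_add_cancel])
  exact ⟨s, h⟩

/-- The identity chain map. -/
noncomputable def Comparison.id (F : GradedFreeResolution.{u} I) : Comparison F F where
  map _ := 1
  homogeneous i b a := by
    rw [one_apply]
    split_ifs with h
    · rw [h, sub_self]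
      exact Or.inr ⟨0, rfl, isHomogeneous_one _ _⟩
    · exact Or.inl rfl
  map_zero := by
    have := F.subsingleton_zero
    ext1 a b
    rw [Subsingleton.elim a b]
    simp
  comm i := by rw [Matrix.mul_one, Matrix.one_mul]

/-- The composite of two chain maps. -/
noncomputable def Comparison.comp {F : GradedFreeResolution.{u} I} {T : GradedFreeResolution.{v} I}
    (B : Comparison T F) (A : Comparison F T) : Comparison F F where
  map i := B.map i * A.map i
  homogeneous i := (B.homogeneous i).mul (A.homogeneous i)
  map_zero := by
    have := T.subsingleton_zero
    obtain ⟨t⟩ := T.nonempty_zero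
    ext1 a b
    rw [A.map_zero, B.map_zero, mul_apply, Fintype.sum_subsingleton _ t]
    simp
  comm i := by
    rw [← Matrix.mul_assoc, B.comm, Matrix.mul_assoc, A.comm, Matrix.mul_assoc]

/-- A resolution is minimal if the entries of its differentials have no constant term. -/
def IsMinimal (F : GradedFreeResolution.{u} I) : Prop :=
  ∀ i, (F.d i).map constantCoeff = 0

/-- Modulo the variables, a minimal resolution is a retract of any other resolution, and the
composite in the other order is homotopic to the identity. -/
theorem IsMinimal.exists_retract {F : GradedFreeResolution.{u} I} (hF : F.IsMinimal)
    (T : GradedFreeResolution.{v} I) (i : ℕ) :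
    ∃ (P : Matrix (T.ι (i + 1)) (F.ι (i + 1)) K) (Q : Matrix (F.ι (i + 1)) (T.ι (i + 1)) K)
      (H : Matrix (T.ι (i + 2)) (T.ι (i + 1)) K) (H' : Matrix (T.ι (i + 1)) (T.ι i) K),
      Q * P = 1 ∧
      P * Q = 1 + ((T.d (i + 1)).map constantCoeff * H + H' * (T.d i).map constantCoeff) ∧
      Q * (T.d (i + 1)).map constantCoeff = 0 ∧
      ∀ b a, P b a ≠ 0 → T.deg (i + 1) b = F.deg (i + 1) a := by
  obtain ⟨A⟩ := nonempty_comparison F T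
  obtain ⟨B⟩ := nonempty_comparison T F
  obtain ⟨H, hH⟩ := (B.comp A).exists_homotopy (Comparison.id F)
  obtain ⟨H', hH'⟩ := (A.comp B).exists_homotopy (Comparison.id T)
  refine ⟨(A.map (i + 1)).map constantCoeff, (B.map (i + 1)).map constantCoeff,
    (H' (i + 1)).map constantCoeff, (H' i).map constantCoeff, ?_, ?_, ?_, ?_⟩
  · have := congrArg (fun M => M.map (constantCoeff (σ := σ) (R := K))) (eq_add_of_sub_eq (hH i))
    simpa [Comparison.comp, Comparison.id, Matrix.map_add, Matrix.map_mul, hF _] using this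
  · have := congrArg (fun M => M.map (constantCoeff (σ := σ) (R := K))) (eq_add_of_sub_eq (hH' i))
    simpa [Comparison.comp, Comparison.id, Matrix.map_add, Matrix.map_mul, add_comm] using this
  · have := congrArg (fun M => M.map (constantCoeff (σ := σ) (R := K))) (B.comm (i + 1))
    simpa [Matrix.map_mul, hF _] using this.symm
  · intro b a h
    exact (A.homogeneous (i + 1)).deg_eq h

end GradedFreeResolution

/-- The resolution by matrices underlying a graded minimal free resolution. -/
noncomputable def GradedMinimalFreeResolution.toGradedFreeResolution {K σ : Type*} [Field K]
    {I : Ideal (MvPolynomial σ K)} (F : GradedMinimalFreeResolution I) :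
    GradedFreeResolution.{0} I where
  ι i := Fin (F.rank i)
  fintype _ := inferInstance
  decEq _ := inferInstance
  deg := F.deg
  d i := LinearMap.toMatrix' (F.diff i)
  nonempty_zero := ⟨⟨0, by rw [F.rank_zero]; exact one_pos⟩⟩
  subsingleton_zero := by rw [F.rank_zero]; infer_instance
  deg_zero := F.deg_zero
  homogeneous i a b := by
    rw [LinearMap.toMatrix'_apply]
    exact F.homogeneous i a b
  exact_zero x := by
    rw [← F.exact_zero]
    simp [← toLin'_apply]
  exact_succ i x := by
    simpa [← toLin'_apply] using F.exact_succ i x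

theorem GradedMinimalFreeResolution.isMinimal {K σ : Type*} [Field K]
    {I : Ideal (MvPolynomial σ K)} (F : GradedMinimalFreeResolution I) :
    F.toGradedFreeResolution.IsMinimal := by
  intro i
  have key : ∀ (a : Fin (F.rank i)) (b : Fin (F.rank (i + 1))),
      constantCoeff (LinearMap.toMatrix' (F.diff i) a b) = 0 := by
    intro a b
    rw [LinearMap.toMatrix'_apply]
    exact mem_span_range_X_iff.1 (F.minimal i a b)
  exact Matrix.ext key

/-! ### The simplicial chain complex of a full simplex -/

section Simplex

variable {A E : Type*} [CommRing A] [LinearOrder E]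

/-- The sign with which the face `S` occurs in the boundary of `insert e S`. -/
def faceSign (A : Type*) [CommRing A] (e : E) (S : Finset E) : A :=
  (-1) ^ (S.filter (· < e)).card

theorem faceSign_eq_one {g : E} {S : Finset E} (h : ∀ e ∈ S, g ≤ e) : faceSign A g S = 1 := by
  rw [faceSign, Finset.filter_false_of_mem fun e he => (h e he).not_gt, Finset.card_empty, pow_zero]

theorem faceSign_insert {e f : E} {S : Finset E} (hf : f ∉ S) :
    faceSign A e (insert f S) = if f < e then -faceSign A e S else faceSign A e S := by
  rw [faceSign, faceSign, Finset.filter_insert]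
  split_ifs with h
  · rw [Finset.card_insert_of_notMem (by simp [hf]), pow_succ]
    ring
  · rfl

variable [Fintype E]

/-- The boundary of a simplicial chain on the simplex with vertex set `E`, where `c S` is the
coefficient of the chain at the face `S`; the empty face is included. -/
def simplexBoundary (c : Finset E → A) (S : Finset E) : A :=
  ∑ e ∈ Sᶜ, faceSign A e S * c (insert e S)

theorem simplexBoundary_simplexBoundary (c : Finset E → A) :
    simplexBoundary (simplexBoundary c) = 0 := by
  funext S
  simp only [simplexBoundary, Finset.mul_sum, Pi.zero_apply]
  rw [Finset.sum_sigma']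
  refine Finset.sum_involution (fun x _ => ⟨x.2, x.1⟩) ?_ ?_ ?_ ?_
  · rintro ⟨e, f⟩ h
    simp only [Finset.mem_sigma, Finset.mem_compl, Finset.mem_insert, not_or] at h
    obtain ⟨he, hfe, hf⟩ := h
    dsimp only
    rw [faceSign_insert he, faceSign_insert hf, Finset.insert_comm f e]
    rcases lt_or_gt_of_ne hfe with h1 | h1
    · rw [if_neg h1.not_gt, if_pos h1]; ring
    · rw [if_neg h1.not_gt, if_pos h1]; ring
  · rintro ⟨e, f⟩ h _ heq
    simp only [Finset.mem_sigma, Finset.mem_compl, Finset.mem_insert, not_or] at h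
    simp only [Sigma.mk.injEq] at heq
    exact h.2.1 heq.1
  · rintro ⟨e, f⟩ h
    simp only [Finset.mem_sigma, Finset.mem_compl, Finset.mem_insert, not_or] at h ⊢
    exact ⟨h.2.2, fun h' => h.2.1 h'.symm, h.1⟩
  · intros; rfl

/-- The cone with apex `g` is a contracting homotopy on the chains supported on faces all of whose
vertices are at least `g`. -/
theorem simplexBoundary_cone {c : Finset E → A} {g : E} (hc : ∀ S, c S ≠ 0 → ∀ e ∈ S, g ≤ e)
    (h0 : simplexBoundary c = 0) :
    simplexBoundary (fun S => if g ∈ S then c (S.erase g) else 0) = c := by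
  funext S
  have hsign : ∀ S S', S ⊆ S' → faceSign A g S * c S' = c S' := by
    intro S S' hS
    by_cases h : c S' = 0
    · simp [h]
    · rw [faceSign_eq_one fun e he => hc S' h e (hS he), one_mul]
  rw [simplexBoundary]
  -- A face containing `g` is compared with the vanishing boundary at the opposite face; moving the
  -- least vertex `g` into the face changes the sign of all other vertices.
  by_cases hg : g ∈ S
  · have h1 := congrFun h0 (S.erase g)
    have h2 : (S.erase g)ᶜ = insert g Sᶜ := by
      ext e
      by_cases h : e = g <;> simp [h]
    rw [simplexBoundary, h2, Finset.sum_insert (by simpa using hg),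
      hsign _ _ (Finset.subset_insert _ _), Finset.insert_erase hg] at h1
    rw [Pi.zero_apply, add_eq_zero_iff_eq_neg, ← Finset.sum_neg_distrib] at h1
    rw [h1]
    refine Finset.sum_congr rfl fun e he => ?_
    have heS : e ∉ S := Finset.mem_compl.1 he
    have hne : g ≠ e := fun h => heS (h ▸ hg)
    rw [if_pos (Finset.mem_insert_of_mem hg), Finset.erase_insert_of_ne hne.symm]
    by_cases h : c (insert e (S.erase g)) = 0
    · simp [h]
    · have hlt : g < e := lt_of_le_of_ne (hc _ h e (Finset.mem_insert_self _ _)) hne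
      have h3 := faceSign_insert (A := A) (e := e) (Finset.notMem_erase g S)
      rw [Finset.insert_erase hg, if_pos hlt] at h3
      rw [h3, neg_mul]
  · rw [Finset.sum_eq_single g]
    · rw [if_pos (Finset.mem_insert_self _ _), Finset.erase_insert hg, hsign S S subset_rfl]
    · intro e _ he
      rw [if_neg (by simp [hg, he.symm]), mul_zero]
    · intro h
      exact absurd (Finset.mem_compl.2 hg) h

end Simplex

/-! ### The Taylor resolution of a monomial ideal -/

section Taylor

variable {K σ : Type*} [Field K] {E : Type u} (m : E → σ →₀ ℕ)

/-- The strand of an element of the `i`-th Taylor module in the multidegree `w`, which is a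
simplicial chain with coefficients in `K`: multiplying the basis elements `S` with their least
common multiples, it consists of the coefficients of the monomial with exponent `w`. -/
noncomputable def taylorStrand {i : ℕ} (v : {S : Finset E // S.card = i} → MvPolynomial σ K)
    (w : σ →₀ ℕ) (S : Finset E) : K :=
  if h : S.card = i then coeff w (monomial (S.sup m) 1 * v ⟨S, h⟩) else 0

variable {m}

theorem taylorStrand_ne_zero {i : ℕ} {v : {S : Finset E // S.card = i} → MvPolynomial σ K}
    {w : σ →₀ ℕ} {S : Finset E} (h : taylorStrand m v w S ≠ 0) : S.card = i ∧ S.sup m ≤ w := by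
  rw [taylorStrand] at h
  split_ifs at h with h1
  · refine ⟨h1, ?_⟩
    rw [coeff_monomial_mul'] at h
    by_contra h2
    simp [h2] at h
  · exact absurd rfl h

theorem taylorStrand_injective {i : ℕ} {v v' : {S : Finset E // S.card = i} → MvPolynomial σ K}
    (h : ∀ w, taylorStrand m v w = taylorStrand m v' w) : v = v' := by
  funext S
  ext u
  have := congrFun (h (S.1.sup m + u)) S.1
  simpa [taylorStrand, S.2, coeff_monomial_mul] using this

theorem taylorStrand_zero {i : ℕ} (w : σ →₀ ℕ) :
    taylorStrand m (0 : {S : Finset E // S.card = i} → MvPolynomial σ K) w = 0 := by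
  funext S
  simp [taylorStrand]

/-- A family of chains is the family of strands of an element of the `i`-th Taylor module if it is
supported on the right faces and if its coefficients at each face vanish in almost all
multidegrees. -/
theorem exists_taylorStrand_eq {i : ℕ} (b : (σ →₀ ℕ) → Finset E → K)
    (hb : ∀ w S, b w S ≠ 0 → S.card = i ∧ S.sup m ≤ w) (hfin : ∀ S, {w | b w S ≠ 0}.Finite) :
    ∃ y : {S : Finset E // S.card = i} → MvPolynomial σ K, ∀ w, taylorStrand m y w = b w := by
  classical
  -- The basis element `S` times the monomial with exponent `u` has multidegree `S.sup m + u`.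
  have hpre : ∀ S, {u | b (S.sup m + u) S ≠ 0}.Finite := fun S =>
    (hfin S).preimage fun x _ y _ hxy => add_left_cancel hxy
  refine ⟨fun S => ∑ u ∈ (hpre S.1).toFinset, monomial u (b (S.1.sup m + u) S.1), fun w => ?_⟩
  funext S
  rw [taylorStrand]
  split_ifs with h
  · rw [coeff_monomial_mul']
    split_ifs with h1
    · simp only [one_mul, coeff_sum, coeff_monomial, Finset.sum_ite_eq']
      rw [add_tsub_cancel_of_le h1]
      split_ifs with h2
      · rfl
      · by_contra h3
        refine h2 ?_
        rw [Set.Finite.mem_toFinset, Set.mem_ofPred, add_tsub_cancel_of_le h1]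
        exact Ne.symm h3
    · by_contra h2
      exact h1 (hb w S (Ne.symm h2)).2
  · by_contra h2
    exact h (hb w S (Ne.symm h2)).1

theorem mem_span_range_monomial_iff {x : MvPolynomial σ K} :
    x ∈ Ideal.span (Set.range fun e => monomial (m e) (1 : K)) ↔
      ∀ w, coeff w x ≠ 0 → ∃ e, m e ≤ w := by
  rw [show (Set.range fun e => monomial (m e) (1 : K)) = (fun s => monomial s 1) '' Set.range m from
    Set.range_comp (fun s => monomial s (1 : K)) m, mem_ideal_span_monomial_image]
  simp [mem_support_iff]

variable [Fintype E] [LinearOrder E]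

variable (K m) in
/-- The matrix of the differential of the Taylor resolution from the module with basis the sets of
`i + 1` generators to the one with basis the sets of `i` generators. The entry at `(S, insert e S)`
is, up to sign, the quotient of the least common multiples of the two sets. -/
noncomputable def taylorMatrix (i : ℕ) :
    Matrix {S : Finset E // S.card = i} {S : Finset E // S.card = i + 1} (MvPolynomial σ K) :=
  Matrix.of fun S T => ∑ e ∈ S.1ᶜ,
    if insert e S.1 = T.1 then monomial (T.1.sup m - S.1.sup m) (faceSign K e S.1) else 0

theorem taylorStrand_mulVec (i : ℕ)
    (v : {S : Finset E // S.card = i + 1} → MvPolynomial σ K) (w : σ →₀ ℕ) :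
    taylorStrand m (taylorMatrix K m i *ᵥ v) w = simplexBoundary (taylorStrand m v w) := by
  funext S
  rw [simplexBoundary, taylorStrand]
  split_ifs with h
  · simp only [mulVec, dotProduct, taylorMatrix, of_apply, Finset.sum_mul]
    rw [Finset.sum_comm, Finset.mul_sum, coeff_sum]
    refine Finset.sum_congr rfl fun e he => ?_
    have hcard : (insert e S).card = i + 1 := by
      rw [Finset.card_insert_of_notMem (Finset.mem_compl.1 he), h]
    rw [Finset.sum_eq_single ⟨insert e S, hcard⟩]
    · rw [if_pos rfl, taylorStrand, dif_pos hcard, ← mul_assoc, monomial_mul, one_mul,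
        add_tsub_cancel_of_le (Finset.sup_mono (Finset.subset_insert _ _)),
        ← mul_one (faceSign K e S), ← C_mul_monomial, mul_assoc, coeff_C_mul, mul_one]
    · intro T _ hT
      rw [if_neg fun h' => hT (Subtype.ext h'.symm), zero_mul]
    · intro h'
      exact absurd (Finset.mem_univ _) h'
  · refine (Finset.sum_eq_zero fun e he => ?_).symm
    by_contra h0
    have := (taylorStrand_ne_zero (right_ne_zero_of_mul h0)).1
    rw [Finset.card_insert_of_notMem (Finset.mem_compl.1 he)] at this
    omega

/-- The Taylor complex is exact, because each strand is a cone whose apex is the first generator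
dividing the monomial of that multidegree. -/
theorem exists_taylorMatrix_mulVec_eq {i : ℕ}
    (v : {S : Finset E // S.card = i} → MvPolynomial σ K)
    (h0 : ∀ w, simplexBoundary (taylorStrand m v w) = 0)
    (hv : ∀ w, taylorStrand m v w ≠ 0 → ∃ e, m e ≤ w) :
    ∃ y, taylorMatrix K m i *ᵥ y = v := by
  have key : ∀ w, ∃ b : Finset E → K, simplexBoundary b = taylorStrand m v w ∧
      ∀ S, b S ≠ 0 → (S.card = i + 1 ∧ S.sup m ≤ w) ∧
        ∃ g ∈ S, taylorStrand m v w (S.erase g) ≠ 0 := by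
    intro w
    by_cases hw : taylorStrand m v w = 0
    · refine ⟨0, ?_, fun S h => absurd rfl h⟩
      rw [hw]
      funext S
      simp [simplexBoundary]
    · have hne : (Finset.univ.filter fun e => m e ≤ w).Nonempty := by
        obtain ⟨e, he⟩ := hv w hw
        exact ⟨e, by simpa using he⟩
      set g := (Finset.univ.filter fun e => m e ≤ w).min' hne with hg
      have hgw : m g ≤ w := by simpa using Finset.min'_mem _ hne
      refine ⟨_, simplexBoundary_cone (g := g) (fun S hS e he => ?_) (h0 w), fun S hS => ?_⟩
      · refine Finset.min'_le _ _ ?_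
        simpa using (Finset.le_sup he).trans (taylorStrand_ne_zero hS).2
      · split_ifs at hS with hgS
        · obtain ⟨h1, h2⟩ := taylorStrand_ne_zero hS
          refine ⟨⟨?_, ?_⟩, g, hgS, hS⟩
          · rw [← h1, Finset.card_erase_add_one hgS]
          · rw [← Finset.insert_erase hgS, Finset.sup_insert]
            exact sup_le hgw h2
        · exact absurd rfl hS
  choose b hb hb' using key
  obtain ⟨y, hy⟩ := exists_taylorStrand_eq b (fun w S h => (hb' w S h).1) fun S => by
    refine (S.finite_toSet.biUnion fun g _ => (show
      {w | taylorStrand m v w (S.erase g) ≠ 0}.Finite from ?_)).subset fun w hw => ?_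
    · by_cases h : (S.erase g).card = i
      · refine (monomial ((S.erase g).sup m) 1 * v ⟨_, h⟩).support.finite_toSet.subset fun w hw => ?_
        rw [Set.mem_ofPred, taylorStrand, dif_pos h] at hw
        exact mem_support_iff.2 hw
      · simp [taylorStrand, h]
    · obtain ⟨-, g, hg, h⟩ := hb' w S hw
      exact Set.mem_biUnion hg h
  refine ⟨y, taylorStrand_injective (m := m) fun w => ?_⟩
  rw [taylorStrand_mulVec, hy, hb]

variable (m)

/-- The Taylor resolution of an ideal generated by monomials. -/
noncomputable def taylorResolution {I : Ideal (MvPolynomial σ K)}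
    (hI : I = Ideal.span (Set.range fun e => monomial (m e) 1)) : GradedFreeResolution.{u} I where
  ι i := {S : Finset E // S.card = i}
  fintype _ := inferInstance
  decEq _ := inferInstance
  deg _ S := (S.1.sup m).degree
  d i := taylorMatrix K m i
  nonempty_zero := ⟨⟨∅, rfl⟩⟩
  subsingleton_zero := ⟨fun S T => Subtype.ext <| by
    rw [Finset.card_eq_zero.1 S.2, Finset.card_eq_zero.1 T.2]⟩
  deg_zero S := by
    rw [Finset.card_eq_zero.1 S.2, Finset.sup_empty]
    rfl
  homogeneous i S T := by
    rw [taylorMatrix, of_apply]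
    refine IsHomogeneousOfIntDegree.sum fun e _ => ?_
    split_ifs with h
    · refine Or.inr ⟨_, ?_, isHomogeneous_monomial _ rfl⟩
      have hle : S.1.sup m ≤ T.1.sup m := by
        rw [← h]
        exact Finset.sup_mono (Finset.subset_insert _ _)
      have := congrArg Finsupp.degree (add_tsub_cancel_of_le hle)
      rw [map_add] at this
      dsimp only
      omega
    · exact Or.inl rfl
  exact_zero x := by
    rw [hI]
    have hcoeff : ∀ S w, taylorStrand m x w S.1 = coeff w (x S) := by
      intro S w
      have h : S.1.sup m = 0 := by rw [Finset.card_eq_zero.1 S.2, Finset.sup_empty]; rfl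
      rw [taylorStrand, dif_pos S.2, h, ← C_apply, map_one, one_mul]
    constructor
    · rintro ⟨y, rfl⟩ S
      refine mem_span_range_monomial_iff.2 fun w hw => ?_
      rw [← hcoeff, taylorStrand_mulVec, simplexBoundary] at hw
      obtain ⟨e, -, he⟩ := Finset.exists_ne_zero_of_sum_ne_zero hw
      exact ⟨e, (Finset.le_sup (Finset.mem_insert_self e S.1)).trans
        (taylorStrand_ne_zero (right_ne_zero_of_mul he)).2⟩
    · intro hx
      refine exists_taylorMatrix_mulVec_eq x (fun w => ?_) fun w hw => ?_
      · funext S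
        refine Finset.sum_eq_zero fun e _ => ?_
        by_contra h
        have := (taylorStrand_ne_zero (right_ne_zero_of_mul h)).1
        exact Finset.insert_ne_empty _ _ (Finset.card_eq_zero.1 this)
      · obtain ⟨S, hS⟩ := Function.ne_iff.1 hw
        have hS0 := (taylorStrand_ne_zero hS).1
        have := hcoeff ⟨S, hS0⟩ w
        exact mem_span_range_monomial_iff.1 (hx ⟨S, hS0⟩) w (this ▸ hS)
  exact_succ i x := by
    constructor
    · intro h
      refine exists_taylorMatrix_mulVec_eq x (fun w => ?_) fun w hw => ?_
      · rw [← taylorStrand_mulVec, h, taylorStrand_zero]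
      · obtain ⟨S, hS⟩ := Function.ne_iff.1 hw
        obtain ⟨h1, h2⟩ := taylorStrand_ne_zero hS
        have hpos : 0 < S.card := h1 ▸ Nat.succ_pos i
        obtain ⟨e, he⟩ := Finset.card_pos.1 hpos
        exact ⟨e, (Finset.le_sup he).trans h2⟩
    · rintro ⟨y, rfl⟩
      refine taylorStrand_injective (m := m) fun w => ?_
      rw [taylorStrand_mulVec, taylorStrand_mulVec, simplexBoundary_simplexBoundary,
        taylorStrand_zero]

variable {m}

/-- Modulo the variables, the differential of the Taylor resolution has an entry only where the
least common multiple does not change. -/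
theorem constantCoeff_taylorMatrix_ne_zero {i : ℕ} {S : {S : Finset E // S.card = i}}
    {T : {S : Finset E // S.card = i + 1}}
    (h : (taylorMatrix K m i).map constantCoeff S T ≠ 0) :
    ∃ e ∉ S.1, insert e S.1 = T.1 ∧ T.1.sup m = S.1.sup m := by
  rw [map_apply, taylorMatrix, of_apply, map_sum] at h
  obtain ⟨e, he, h1⟩ := Finset.exists_ne_zero_of_sum_ne_zero h
  split_ifs at h1 with h2
  · refine ⟨e, Finset.mem_compl.1 he, h2, le_antisymm ?_ ?_⟩
    · rw [← tsub_eq_zero_iff_le]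
      by_contra h3
      classical
      simp [constantCoeff_eq, coeff_monomial, h3] at h1
    · rw [← h2]
      exact Finset.sup_mono (Finset.subset_insert _ _)
  · simp at h1

theorem constantCoeff_taylorMatrix_insert {i : ℕ} {S : {S : Finset E // S.card = i}}
    {T : {S : Finset E // S.card = i + 1}} {e : E} (he : e ∉ S.1) (hT : insert e S.1 = T.1)
    (hsup : T.1.sup m = S.1.sup m) : (taylorMatrix K m i).map constantCoeff S T ≠ 0 := by
  classical
  rw [map_apply, taylorMatrix, of_apply, Finset.sum_eq_single e]
  · rw [if_pos hT, hsup, tsub_self, constantCoeff_monomial]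
    simp [faceSign]
  · intro f hf hfe
    rw [if_neg]
    intro h
    have : e ∈ insert f S.1 := by rw [h, ← hT]; exact Finset.mem_insert_self _ _
    rcases Finset.mem_insert.1 this with h1 | h1
    · exact hfe h1.symm
    · exact he h1
  · intro h
    exact absurd (Finset.mem_compl.2 he) h

end Taylor

/-! ### Existence of minimal resolutions -/

section Existence

variable {K σ : Type*} [Field K] [Finite σ]

/-- A graded submodule of a graded free module is the image of a degree preserving map from a
graded free module whose kernel involves no constants: a generating family of homogeneous elements
of minimal cardinality has no relation with an invertible coefficient. -/
theorem exists_minimal_generators {γ : Type*} [Fintype γ] (deg : γ → ℤ)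
    (N : Submodule (MvPolynomial σ K) (γ → MvPolynomial σ K))
    (hN : ∀ e v, v ∈ N → vecComponent deg e v ∈ N) :
    ∃ (r : ℕ) (deg' : Fin r → ℤ) (A : Matrix γ (Fin r) (MvPolynomial σ K)),
      IsHomogeneousMatrix deg deg' A ∧ LinearMap.range A.mulVecLin = N ∧
      ∀ y, A *ᵥ y = 0 → ∀ b, constantCoeff (y b) = 0 := by
  classical
  have hex : ∃ r, ∃ (deg' : Fin r → ℤ) (A : Matrix γ (Fin r) (MvPolynomial σ K)),
      IsHomogeneousMatrix deg deg' A ∧ Submodule.span _ (Set.range A.col) = N := by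
    have hspan : Submodule.span (MvPolynomial σ K) {v | v ∈ N ∧ ∃ e, vecComponent deg e v = v} =
        N := by
      refine le_antisymm (Submodule.span_le.2 fun v hv => hv.1) fun v hv => ?_
      obtain ⟨s, hs⟩ := exists_eq_sum_vecComponent deg v
      rw [hs]
      exact Submodule.sum_mem _ fun e _ =>
        Submodule.subset_span ⟨hN e v hv, e, vecComponent_vecComponent _ _ _⟩
    have hfg : N.FG := IsNoetherian.noetherian N
    rw [← hspan, Submodule.fg_span_iff_fg_span_finset_subset] at hfg
    obtain ⟨t, ht, hspan'⟩ := hfg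
    have hdeg : ∀ k : Fin t.card, ∃ e, vecComponent deg e (t.equivFin.symm k).1 =
      (t.equivFin.symm k).1 := fun k => (ht (t.equivFin.symm k).2).2
    choose deg' hdeg' using hdeg
    refine ⟨t.card, deg', Matrix.of fun a k => (t.equivFin.symm k).1 a, fun a k => ?_, ?_⟩
    · rw [of_apply, ← congrFun (hdeg' k) a]
      exact isHomogeneousOfIntDegree_intComponent _ _
    · rw [← hspan, hspan']
      congr 1
      ext v
      constructor
      · rintro ⟨k, rfl⟩
        exact (t.equivFin.symm k).2
      · intro hv
        refine ⟨t.equivFin ⟨v, hv⟩, ?_⟩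
        funext a
        simp
  obtain ⟨deg', A, hA, hspan⟩ := Nat.find_spec hex
  have hmin := fun k => Nat.find_min hex (m := k)
  generalize Nat.find hex = r at deg' A hA hspan hmin
  refine ⟨r, deg', A, hA, by rw [range_mulVecLin, hspan], fun y hy b => ?_⟩
  by_contra hb
  obtain ⟨n, rfl⟩ : ∃ n, r = n + 1 := ⟨r - 1, by have := b.2; omega⟩
  set z := vecComponent deg' (deg' b) y with hz
  have hAz : A *ᵥ z = 0 := by rw [hz, ← hA.vecComponent_mulVec, hy, vecComponent_zero]
  -- In the component of the relation in the degree of `b`, the coefficient of `b` is a unit.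
  obtain ⟨c, hc, hzb⟩ : ∃ c : K, c ≠ 0 ∧ z b = C c := by
    refine ⟨_, hb, ?_⟩
    rw [← constantCoeff_intComponent_zero]
    have h : z b = intComponent 0 (y b) := by rw [hz, vecComponent, sub_self]
    rw [h]
    exact (isHomogeneousOfIntDegree_intComponent 0 _).eq_C
  refine hmin n (Nat.lt_succ_self n) ⟨fun k => deg' (b.succAbove k),
    A.submatrix id b.succAbove, fun a k => hA a _, ?_⟩
  rw [← hspan]
  refine le_antisymm (Submodule.span_mono ?_) (Submodule.span_le.2 ?_)
  · rintro _ ⟨k, rfl⟩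
    exact ⟨b.succAbove k, rfl⟩
  · rintro _ ⟨k, rfl⟩
    rcases Fin.eq_self_or_eq_succAbove b k with rfl | ⟨k, rfl⟩
    · have hsum : z k • A.col k + ∑ j, z (k.succAbove j) • A.col (k.succAbove j) = 0 := by
        rw [← Fin.sum_univ_succAbove (fun j => z j • A.col j) k, ← hAz]
        funext a
        simp [mulVec, dotProduct, Finset.sum_apply, mul_comm]
      have hcol : A.col k = -(C c⁻¹ : MvPolynomial σ K) •
          ∑ j, z (k.succAbove j) • A.col (k.succAbove j) := by
        rw [neg_smul, ← smul_neg, ← eq_neg_of_add_eq_zero_left hsum, hzb, smul_smul, ← C_mul,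
          inv_mul_cancel₀ hc, C_1, one_smul]
      rw [hcol]
      exact Submodule.smul_mem _ _ (Submodule.sum_mem _ fun j _ =>
        Submodule.smul_mem _ _ (Submodule.subset_span ⟨j, rfl⟩))
    · exact Submodule.subset_span ⟨k, rfl⟩

variable (K σ) in
/-- A stage in the construction of a minimal resolution: a graded free module with a graded
submodule of relations, none of which involves constants. -/
structure SyzygyStage where
  /-- the number of basis elements -/
  rank : ℕ
  /-- the degrees of the basis elements -/
  deg : Fin rank → ℤ
  /-- the module of relations -/
  syz : Submodule (MvPolynomial σ K) (Fin rank → MvPolynomial σ K)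
  graded : ∀ e v, v ∈ syz → vecComponent deg e v ∈ syz
  constantCoeff_eq_zero : ∀ v ∈ syz, ∀ a, constantCoeff (v a) = 0

theorem SyzygyStage.exists_next (S : SyzygyStage K σ) : ∃ (T : SyzygyStage K σ)
    (A : Matrix (Fin S.rank) (Fin T.rank) (MvPolynomial σ K)), IsHomogeneousMatrix S.deg T.deg A ∧
      LinearMap.range A.mulVecLin = S.syz ∧ LinearMap.ker A.mulVecLin = T.syz := by
  obtain ⟨r, deg', A, hA, hrange, hker⟩ := exists_minimal_generators S.deg S.syz S.graded
  refine ⟨⟨r, deg', LinearMap.ker A.mulVecLin, fun e v hv => ?_, fun v hv => ?_⟩, A, hA, hrange, rfl⟩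
  · rw [LinearMap.mem_ker, mulVecLin_apply] at hv ⊢
    rw [← hA.vecComponent_mulVec, hv, vecComponent_zero]
  · exact hker v hv

/-- A homogeneous ideal without constants has a minimal graded free resolution. It is also a finite
one as soon as the modules of some graded free resolution vanish eventually, because a minimal
resolution is a retract of any other one modulo the variables. -/
theorem nonempty_gradedMinimalFreeResolution {I : Ideal (MvPolynomial σ K)}
    (hI : ∀ e, ∀ p ∈ I, intComponent e p ∈ I) (hI0 : ∀ p ∈ I, constantCoeff p = 0)
    (T : GradedFreeResolution I) (hT : ∃ n, ∀ i, n < i → IsEmpty (T.ι i)) :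
    Nonempty (GradedMinimalFreeResolution I) := by
  classical
  obtain ⟨s, h0, -, hs⟩ := exists_seq_of_step (X := fun _ => SyzygyStage K σ) (fun _ _ => True)
    (fun _ S T => ∃ A : Matrix (Fin S.rank) (Fin T.rank) (MvPolynomial σ K),
      IsHomogeneousMatrix S.deg T.deg A ∧
      LinearMap.range A.mulVecLin = S.syz ∧ LinearMap.ker A.mulVecLin = T.syz)
    ⟨1, 0, Submodule.pi Set.univ fun _ => I,
      fun e v hv => by
        rw [Submodule.mem_pi] at hv ⊢
        exact fun a ha => hI _ _ (hv a ha),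
      fun v hv a => hI0 _ ((Submodule.mem_pi.1 hv) a (Set.mem_univ a))⟩ trivial
    (fun _ S _ => by
      obtain ⟨T, hT⟩ := S.exists_next
      exact ⟨T, trivial, hT⟩)
  choose A hA hrange hker using hs
  have hr0 : (s 0).rank = 1 := by rw [h0]
  have hd0 : ∀ a, (s 0).deg a = 0 := by rw [h0]; intro a; rfl
  have hsyz0 : ∀ x, x ∈ (s 0).syz ↔ ∀ a, x a ∈ I := by
    rw [h0]
    intro x
    simp [Submodule.mem_pi]
  have hmin : ∀ i a b, constantCoeff (A i a b) = 0 := by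
    intro i a b
    have h : A i *ᵥ Pi.single b 1 ∈ (s i).syz := by
      rw [← hrange]
      exact ⟨_, rfl⟩
    rw [mulVec_single_one] at h
    exact (s i).constantCoeff_eq_zero _ h a
  have hexact : ∀ i x, A i *ᵥ x = 0 ↔ ∃ y, A (i + 1) *ᵥ y = x := by
    intro i x
    rw [← mulVecLin_apply, ← LinearMap.mem_ker, hker, ← hrange]
    rfl
  have hzero : ∀ x, (∃ y, A 0 *ᵥ y = x) ↔ ∀ a, x a ∈ I := by
    intro x
    rw [← hsyz0, ← hrange]
    rfl
  let F : GradedFreeResolution.{0} I :=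
    { ι := fun i => Fin (s i).rank
      fintype := fun _ => inferInstance
      decEq := fun _ => inferInstance
      deg := fun i => (s i).deg
      d := A
      nonempty_zero := ⟨⟨0, by rw [hr0]; exact one_pos⟩⟩
      subsingleton_zero := by rw [hr0]; infer_instance
      deg_zero := hd0
      homogeneous := hA
      exact_zero := hzero
      exact_succ := hexact }
  have hF : F.IsMinimal := fun i => Matrix.ext (hmin i)
  obtain ⟨n, hn⟩ := hT
  refine ⟨⟨fun i => (s i).rank, fun i => (s i).deg, fun i => (A i).mulVecLin, hr0, hd0, ⟨n, ?_⟩,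
    fun i a b => ?_, fun i a b => ?_, hzero, fun i x => hexact i x⟩⟩
  · intro i hi
    obtain ⟨j, rfl⟩ : ∃ j, i = j + 1 := ⟨i - 1, by omega⟩
    have := hn _ hi
    obtain ⟨P, Q, -, -, hQP, -⟩ := hF.exists_retract T j
    by_contra h
    have h1 := congrFun (congrFun hQP ⟨0, Nat.pos_of_ne_zero h⟩) ⟨0, Nat.pos_of_ne_zero h⟩
    rw [one_apply_eq, mul_apply, Finset.univ_eq_empty, Finset.sum_empty] at h1
    exact zero_ne_one h1
  · rw [mulVecLin_apply, mulVec_single_one]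
    exact hA i a b
  · rw [mulVecLin_apply, mulVec_single_one, mem_span_range_X_iff]
    exact hmin i a b

end Existence

/-! ### Betti numbers in the top degree -/

section TopDegree

variable {K σ : Type*} [Field K]

theorem GradedFreeResolution.IsMinimal.exists_deg_eq {I : Ideal (MvPolynomial σ K)}
    {F : GradedFreeResolution.{u} I} (hF : F.IsMinimal) (T : GradedFreeResolution.{v} I) (i : ℕ)
    (a : F.ι (i + 1)) : ∃ b : T.ι (i + 1), T.deg (i + 1) b = F.deg (i + 1) a := by
  obtain ⟨P, Q, -, -, hQP, -, -, hP⟩ := hF.exists_retract T i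
  have h : (Q * P) a a ≠ 0 := by rw [hQP, one_apply_eq]; exact one_ne_zero
  rw [mul_apply] at h
  obtain ⟨b, -, hb⟩ := Finset.exists_ne_zero_of_sum_ne_zero h
  exact ⟨b, hP b a (right_ne_zero_of_mul hb)⟩

/-- Counting the basis elements of degree `d` in a minimal resolution by means of any resolution
`T`. Modulo the variables, let a set `s` of basis elements of degree `d` consist of cycles that
occur in no boundary, and let every other basis element of degree `d` be a boundary up to a nonzero
factor. Then `s` represents a basis of the degree `d` part of the homology of `T` modulo the
variables, and the comparison matrices restrict to mutually inverse matrices between `s` and the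
basis elements of degree `d` of the minimal resolution. -/
theorem GradedFreeResolution.IsMinimal.card_deg_eq {I : Ideal (MvPolynomial σ K)}
    {F : GradedFreeResolution.{u} I} (hF : F.IsMinimal) (T : GradedFreeResolution.{v} I) (i : ℕ)
    (d : ℤ) (s : Finset (T.ι (i + 1))) (hs : ∀ b ∈ s, T.deg (i + 1) b = d)
    (hout : ∀ b ∈ s, ∀ c, (T.d i).map constantCoeff c b = 0)
    (hin : ∀ b ∈ s, ∀ c, (T.d (i + 1)).map constantCoeff b c = 0)
    (himage : ∀ b ∉ s, T.deg (i + 1) b = d → ∃ c, (T.d (i + 1)).map constantCoeff b c ≠ 0 ∧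
      ∀ b', b' ≠ b → (T.d (i + 1)).map constantCoeff b' c = 0) :
    (Finset.univ.filter fun a => F.deg (i + 1) a = d).card = s.card := by
  classical
  obtain ⟨P, Q, H, H', hQP, hPQ, hQd, hP⟩ := hF.exists_retract T i
  -- `Q` kills boundaries, as the differential of the minimal resolution vanishes modulo variables.
  have hQ : ∀ a b, b ∉ s → T.deg (i + 1) b = d → Q a b = 0 := by
    intro a b hb hdeg
    obtain ⟨c, hc, hc'⟩ := himage b hb hdeg
    have h := congrFun (congrFun hQd a) c
    rw [mul_apply, Finset.sum_eq_single b (fun b' _ h' => by rw [hc' b' h', mul_zero])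
      (fun h' => absurd (Finset.mem_univ _) h')] at h
    exact (mul_eq_zero.1 h).resolve_right hc
  set r := Finset.univ.filter fun a => F.deg (i + 1) a = d with hr
  have key := square_of_invertible (R := K) (n := r) (m := s)
    (Q.submatrix Subtype.val Subtype.val) (P.submatrix Subtype.val Subtype.val) ?_ ?_
  · simpa using key
  · ext1 a a'
    have h := congrFun (congrFun hQP a.1) a'.1
    rw [mul_apply, ← Finset.sum_subset (Finset.subset_univ s), ← Finset.sum_coe_sort] at h
    · rw [mul_apply]
      refine h.trans ?_
      by_cases haa : a = a'
      · rw [haa, one_apply_eq, one_apply_eq]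
      · rw [one_apply_ne haa, one_apply_ne fun h => haa (Subtype.ext h)]
    · intro b _ hb
      by_cases hPb : P b a'.1 = 0
      · rw [hPb, mul_zero]
      · have h1 : F.deg (i + 1) a'.1 = d := (Finset.mem_filter.1 a'.2).2
        rw [hQ a b hb ((hP b a' hPb).trans h1), zero_mul]
  · ext1 b b'
    have h := congrFun (congrFun hPQ b.1) b'.1
    rw [mul_apply, ← Finset.sum_subset (Finset.subset_univ r), ← Finset.sum_coe_sort] at h
    · rw [mul_apply]
      refine h.trans ?_
      have h1 : ((T.d (i + 1)).map constantCoeff * H) b.1 b'.1 = 0 := by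
        rw [mul_apply]
        exact Finset.sum_eq_zero fun c _ => by rw [hin b b.2, zero_mul]
      have h2 : (H' * (T.d i).map constantCoeff) b.1 b'.1 = 0 := by
        rw [mul_apply]
        exact Finset.sum_eq_zero fun c _ => by rw [hout b' b'.2, mul_zero]
      rw [Matrix.add_apply, Matrix.add_apply, h1, h2, add_zero, add_zero]
      by_cases hbb : b = b'
      · rw [hbb, one_apply_eq, one_apply_eq]
      · rw [one_apply_ne hbb, one_apply_ne fun h => hbb (Subtype.ext h)]
    · intro a _ ha
      by_cases hPa : P b.1 a = 0
      · rw [hPa, zero_mul]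
      · refine absurd (Finset.mem_filter.2 ⟨Finset.mem_univ _, ?_⟩) ha
        rw [← hP b a hPa, hs b b.2]

end TopDegree

/-! ### Squarefree monomials and induced matchings -/

section SquarefreeExponent

variable {σ : Type*}

/-- The exponent of the squarefree monomial with variables in `s`. -/
noncomputable def squarefreeExponent (s : Finset σ) : σ →₀ ℕ := Finsupp.indicator s fun _ _ => 1

open Classical in
theorem squarefreeExponent_apply (s : Finset σ) (x : σ) :
    squarefreeExponent s x = if x ∈ s then 1 else 0 := by
  rw [squarefreeExponent, Finsupp.indicator_apply]
  split_ifs <;> rfl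

theorem squarefreeExponent_injective : Function.Injective (squarefreeExponent (σ := σ)) := by
  classical
  intro s s' h
  ext x
  have := DFunLike.congr_fun h x
  rw [squarefreeExponent_apply, squarefreeExponent_apply] at this
  by_cases h1 : x ∈ s <;> by_cases h2 : x ∈ s' <;> simp_all

theorem degree_squarefreeExponent (s : Finset σ) : (squarefreeExponent s).degree = s.card := by
  classical
  rw [Finsupp.degree_apply, Finset.sum_subset (s₂ := s)]
  · rw [Finset.card_eq_sum_ones]
    exact Finset.sum_congr rfl fun x hx => by rw [squarefreeExponent_apply, if_pos hx]
  · intro x hx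
    by_contra h
    rw [Finsupp.mem_support_iff, squarefreeExponent_apply, if_neg h] at hx
    exact hx rfl
  · intro x _ hx
    rwa [Finsupp.notMem_support_iff] at hx

theorem sup_squarefreeExponent [DecidableEq σ] {E : Type*} (t : E → Finset σ) (S : Finset E) :
    (S.sup fun e => squarefreeExponent (t e)) = squarefreeExponent (S.biUnion t) := by
  classical
  induction S using Finset.induction_on with
  | empty =>
    ext x
    rw [squarefreeExponent_apply, if_neg (by simp)]
    rfl
  | insert e S _ ih =>
    rw [Finset.sup_insert, ih, Finset.biUnion_insert]
    ext x
    rw [Finsupp.sup_apply]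
    simp only [squarefreeExponent_apply, Finset.mem_union]
    by_cases h1 : x ∈ t e <;> by_cases h2 : x ∈ S.biUnion t <;> simp [h1, h2]

end SquarefreeExponent

section InducedMatching

variable {K σ : Type*} [Field K] [DecidableEq σ] {E : Type u}
  {t : E → Finset σ}

theorem disjoint_of_card_biUnion [DecidableEq E] (ht : ∀ e, (t e).card = 2) {S : Finset E}
    (hS : (S.biUnion t).card = 2 * S.card) {f : E} (hf : f ∈ S) :
    Disjoint (t f) ((S.erase f).biUnion t) := by
  have hsplit : S.biUnion t = t f ∪ (S.erase f).biUnion t := by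
    rw [← Finset.biUnion_insert, Finset.insert_erase hf]
  have hle : ((S.erase f).biUnion t).card ≤ (S.erase f).card * 2 :=
    Finset.card_biUnion_le_card_mul _ _ _ fun e _ => (ht e).le
  have hcard := Finset.card_erase_add_one hf
  rw [Finset.disjoint_iff_inter_eq_empty, ← Finset.card_eq_zero]
  have h1 := Finset.card_union_add_card_inter (t f) ((S.erase f).biUnion t)
  rw [← hsplit, hS, ht] at h1
  omega

/-- If the edges of `S` are pairwise disjoint, then an edge `f` of `S` cannot be exchanged for
another edge without losing a vertex. -/
theorem eq_of_biUnion_subset_insert_erase [DecidableEq E] (ht : ∀ e, (t e).card = 2)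
    (hinj : Function.Injective t) {S : Finset E} (hS : (S.biUnion t).card = 2 * S.card) {e f : E}
    (hf : f ∈ S)
    (h : S.biUnion t ⊆ (insert e (S.erase f)).biUnion t) : f = e := by
  have hdisj := disjoint_of_card_biUnion ht hS hf
  refine hinj (Finset.eq_of_subset_of_card_le (fun x hx => ?_) ((ht e).trans (ht f).symm).le)
  have h1 := h (Finset.mem_biUnion.2 ⟨f, hf, hx⟩)
  rw [Finset.biUnion_insert, Finset.mem_union] at h1
  exact h1.resolve_right (Finset.disjoint_left.1 hdisj hx)

variable (t) in
/-- A set of edges, given by their sets of ends, is an induced matching if the edges are pairwise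
disjoint, that is, their union is as large as possible, and if it contains every edge inside
that union. -/
def IsInducedMatching (S : Finset E) : Prop :=
  (S.biUnion t).card = 2 * S.card ∧ ∀ e, t e ⊆ S.biUnion t → e ∈ S

variable [Fintype E] [LinearOrder E] {I : Ideal (MvPolynomial σ K)}

/-- The degree of a basis element of the Taylor resolution of an edge ideal is the number of
vertices that its edges cover. -/
theorem taylorResolution_deg
    (hI : I = Ideal.span (Set.range fun e => monomial (squarefreeExponent (t e)) (1 : K))) (i : ℕ)
    (S : {S : Finset E // S.card = i}) :
    (taylorResolution _ hI).deg i S = (S.1.biUnion t).card := by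
  change (((S.1.sup fun e => squarefreeExponent (t e)).degree : ℕ) : ℤ) = _
  rw [sup_squarefreeExponent, degree_squarefreeExponent]

theorem GradedFreeResolution.IsMinimal.deg_le_two_mul {F : GradedFreeResolution.{v} I}
    (hF : F.IsMinimal) (ht : ∀ e, (t e).card = 2)
    (hI : I = Ideal.span (Set.range fun e => monomial (squarefreeExponent (t e)) (1 : K))) (i : ℕ)
    (a : F.ι (i + 1)) : F.deg (i + 1) a ≤ 2 * ((i + 1 : ℕ) : ℤ) := by
  obtain ⟨S, hS⟩ := hF.exists_deg_eq (taylorResolution _ hI) i a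
  rw [← hS, taylorResolution_deg hI (i + 1) S]
  have h : (S.1.biUnion t).card ≤ S.1.card * 2 :=
    Finset.card_biUnion_le_card_mul _ _ _ fun e _ => (ht e).le
  rw [S.2] at h
  omega

open Classical in
/-- The Betti number in the top degree counts the induced matchings: in the Taylor resolution
modulo the variables, a matching `S` that is not induced is up to sign the boundary of
`insert e S`, where `e` is a further edge inside the vertex set of `S`, and an induced matching
occurs in no boundary. -/
theorem GradedFreeResolution.IsMinimal.card_deg_eq_two_mul {F : GradedFreeResolution.{v} I}
    (hF : F.IsMinimal) (ht : ∀ e, (t e).card = 2) (hinj : Function.Injective t)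
    (hI : I = Ideal.span (Set.range fun e => monomial (squarefreeExponent (t e)) (1 : K)))
    (i : ℕ) : (Finset.univ.filter fun a => F.deg (i + 1) a = 2 * ((i + 1 : ℕ) : ℤ)).card =
      (Finset.univ.filter fun S : Finset E => S.card = i + 1 ∧ IsInducedMatching t S).card := by
  have hsup : ∀ {S T : Finset E}, (T.sup fun e => squarefreeExponent (t e)) =
      (S.sup fun e => squarefreeExponent (t e)) ↔ T.biUnion t = S.biUnion t := by
    intro S T
    rw [sup_squarefreeExponent, sup_squarefreeExponent, squarefreeExponent_injective.eq_iff]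
  rw [hF.card_deg_eq (taylorResolution _ hI) i (2 * ((i + 1 : ℕ) : ℤ))
    (Finset.univ.filter fun S : {S : Finset E // S.card = i + 1} => IsInducedMatching t S.1)]
  · refine Finset.card_bij (fun S _ => S.1) ?_ (fun _ _ _ _ h => Subtype.ext h) ?_
    · intro S hS
      exact Finset.mem_filter.2 ⟨Finset.mem_univ _, S.2, (Finset.mem_filter.1 hS).2⟩
    · intro S hS
      obtain ⟨-, h1, h2⟩ := Finset.mem_filter.1 hS
      exact ⟨⟨S, h1⟩, Finset.mem_filter.2 ⟨Finset.mem_univ _, h2⟩, rfl⟩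
  · intro S hS
    rw [taylorResolution_deg hI (i + 1) S, (Finset.mem_filter.1 hS).2.1, S.2]
    push_cast
    ring
  · intro S hS T
    by_contra h
    obtain ⟨e, -, -, h2⟩ := constantCoeff_taylorMatrix_ne_zero h
    have h3 := congrArg Finset.card (hsup.1 h2)
    have h4 : (T.1.biUnion t).card ≤ T.1.card * 2 :=
      Finset.card_biUnion_le_card_mul _ _ _ fun e _ => (ht e).le
    rw [(Finset.mem_filter.1 hS).2.1, S.2] at h3
    rw [T.2] at h4
    omega
  · intro S hS T
    by_contra h
    obtain ⟨e, he, h1, h2⟩ := constantCoeff_taylorMatrix_ne_zero h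
    refine he ((Finset.mem_filter.1 hS).2.2 e ?_)
    rw [← hsup.1 h2, ← h1]
    exact Finset.subset_biUnion_of_mem t (Finset.mem_insert_self _ _)
  · intro S hS hdeg
    rw [taylorResolution_deg hI (i + 1) S] at hdeg
    have hcard : (S.1.biUnion t).card = 2 * S.1.card := by
      rw [S.2]
      exact_mod_cast hdeg
    obtain ⟨e, he, heS⟩ : ∃ e, t e ⊆ S.1.biUnion t ∧ e ∉ S.1 := by
      by_contra! h
      exact hS (Finset.mem_filter.2 ⟨Finset.mem_univ _, hcard, h⟩)
    have hun : (insert e S.1).biUnion t = S.1.biUnion t := by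
      rw [Finset.biUnion_insert, Finset.union_eq_right.2 he]
    refine ⟨⟨insert e S.1, by rw [Finset.card_insert_of_notMem heS, S.2]⟩,
      constantCoeff_taylorMatrix_insert heS rfl (hsup.2 hun), fun S' hS' => ?_⟩
    by_contra h
    obtain ⟨f, hf, h1, h2⟩ := constantCoeff_taylorMatrix_ne_zero h
    dsimp only at h1 h2
    have hS'' : S'.1 = (insert e S.1).erase f := by rw [← h1, Finset.erase_insert hf]
    by_cases hfe : f = e
    · refine hS' (Subtype.ext ?_)
      rw [hS'', hfe, Finset.erase_insert heS]
    · have hfS : f ∈ S.1 := by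
        have : f ∈ insert e S.1 := h1 ▸ Finset.mem_insert_self f S'.1
        exact (Finset.mem_insert.1 this).resolve_left hfe
      refine hfe (eq_of_biUnion_subset_insert_erase ht hinj hcard hfS ?_)
      rw [← Finset.erase_insert_of_ne (Ne.symm hfe), ← hS'', ← hsup.1 h2, hun]

end InducedMatching

/-! ### Edge ideals -/

section EdgeIdeal

variable {V E : Type*}

theorem edgeIdeal_eq_span_squarefreeExponent (K : Type*) [Field K] [DecidableEq V]
    (G : SimpleGraph V) (f : E ≃ G.edgeSet) :
    G.edgeIdeal K = Ideal.span (Set.range fun e =>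
      monomial (squarefreeExponent (f e).1.toFinset) (1 : K)) := by
  have hpair : ∀ u v, G.Adj u v →
      monomial (squarefreeExponent (s(u, v) : Sym2 V).toFinset) (1 : K) = X u * X v := by
    intro u v huv
    rw [X, X, monomial_mul, one_mul]
    refine congrArg (fun w => monomial w (1 : K)) (Finsupp.ext fun x => ?_)
    have hne := huv.ne
    rw [squarefreeExponent_apply, Finsupp.add_apply, Finsupp.single_apply, Finsupp.single_apply]
    by_cases h1 : u = x <;> by_cases h2 : v = x <;> simp_all [eq_comm]
  rw [SimpleGraph.edgeIdeal]
  congr 1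
  ext p
  constructor
  · rintro ⟨u, v, huv, rfl⟩
    exact ⟨f.symm ⟨s(u, v), huv⟩, by simp only [Equiv.apply_symm_apply]; exact hpair u v huv⟩
  · rintro ⟨e, rfl⟩
    obtain ⟨⟨u, v⟩, hx⟩ := (f e).1.exists_rep
    have huv : G.Adj u v := by
      have h := (f e).2
      rw [← hx] at h
      exact h
    refine ⟨u, v, huv, ?_⟩
    rw [← hpair u v huv]
    exact congrArg (fun x : Sym2 V => monomial (squarefreeExponent x.toFinset) (1 : K)) hx.symm

variable {G : SimpleGraph V} (f : E ≃ G.edgeSet)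

theorem card_toFinset_edge [DecidableEq V] (e : E) : (f e).1.toFinset.card = 2 :=
  Sym2.card_toFinset_of_not_isDiag _ (G.not_isDiag_of_mem_edgeSet (f e).2)

theorem toFinset_edge_injective [DecidableEq V] :
    Function.Injective fun e => (f e).1.toFinset := by
  intro e e' h
  refine f.injective (Subtype.ext (Sym2.ext fun x => ?_))
  have := congrArg (x ∈ ·) h
  simpa [Sym2.mem_toFinset] using this

variable [Fintype E]

open Classical in
/-- The edges of a subgraph, as a set of indices. -/
noncomputable def edgeIndices (H : G.Subgraph) : Finset E :=
  Finset.univ.filter fun e => (f e).1 ∈ H.edgeSet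

theorem mem_edgeIndices {H : G.Subgraph} {e : E} :
    e ∈ edgeIndices f H ↔ (f e).1 ∈ H.edgeSet := by
  simp [edgeIndices]

theorem image_edgeIndices (H : G.Subgraph) : (fun e => (f e).1) '' edgeIndices f H = H.edgeSet := by
  ext x
  constructor
  · rintro ⟨e, he, rfl⟩
    exact (mem_edgeIndices f).1 he
  · intro hx
    refine ⟨f.symm ⟨x, H.edgeSet_subset hx⟩, ?_, by simp⟩
    rw [Finset.mem_coe, mem_edgeIndices]
    simpa using hx

theorem card_edgeIndices (H : G.Subgraph) : (edgeIndices f H).card = H.edgeSet.ncard := by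
  have hinj : Function.Injective fun e => (f e).1 := Subtype.val_injective.comp f.injective
  rw [← image_edgeIndices f, Set.ncard_image_of_injective _ hinj, Set.ncard_coe_finset]

variable [DecidableEq V]

theorem coe_biUnion_edgeIndices {H : G.Subgraph} (hH : H.IsMatching) :
    ((edgeIndices f H).biUnion fun e => (f e).1.toFinset : Set V) = H.verts := by
  ext x
  simp only [Finset.coe_biUnion, Set.mem_iUnion, Finset.mem_coe, mem_edgeIndices,
    Sym2.mem_toFinset, exists_prop]
  constructor
  · rintro ⟨e, he, hx⟩
    exact H.mem_verts_of_mem_edge he hx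
  · intro hx
    obtain ⟨y, hy, -⟩ := hH hx
    refine ⟨f.symm ⟨s(x, y), hy.adj_sub⟩, ?_, ?_⟩ <;> simp [hy]

theorem isInducedMatching_edgeIndices {H : G.Subgraph} (hind : H.IsInduced) (hH : H.IsMatching) :
    IsInducedMatching (fun e => (f e).1.toFinset) (edgeIndices f H) := by
  have hverts := coe_biUnion_edgeIndices f hH
  constructor
  · rw [Finset.card_biUnion, Finset.sum_congr rfl fun e _ => card_toFinset_edge f e,
      Finset.sum_const, smul_eq_mul, mul_comm]
    intro e he e' he' hne
    refine Finset.disjoint_left.2 fun x hx hx' => ?_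
    rw [Finset.mem_coe, mem_edgeIndices] at *
    rw [Sym2.mem_toFinset] at hx hx'
    obtain ⟨y, hy⟩ := hx
    obtain ⟨z, hz⟩ := hx'
    rw [hy] at he
    rw [hz] at he'
    have hyz : y = z := hH.eq_of_adj_left he he'
    exact hne (f.injective (Subtype.ext (by rw [hy, hz, hyz])))
  · intro e he
    rw [mem_edgeIndices]
    obtain ⟨⟨u, v⟩, hx⟩ := (f e).1.exists_rep
    have hmem : ∀ x ∈ (f e).1, x ∈ H.verts := by
      intro x hx
      rw [← hverts]
      exact he (Sym2.mem_toFinset.2 hx)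
    have huv := (f e).2
    rw [← hx] at huv hmem ⊢
    exact hind (hmem u (Sym2.mem_mk_left u v)) (hmem v (Sym2.mem_mk_right u v)) huv

/-- Every induced matching consists of the edges of the subgraph induced on its vertices. -/
theorem exists_edgeIndices_eq {S : Finset E}
    (hS : IsInducedMatching (fun e => (f e).1.toFinset) S) :
    ∃ H : G.Subgraph, H.IsInduced ∧ H.IsMatching ∧ edgeIndices f H = S := by
  classical
  set U : Finset V := S.biUnion fun e => (f e).1.toFinset
  have hmemU : ∀ e ∈ S, ∀ x ∈ (f e).1, x ∈ U := fun e he x hx =>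
    Finset.mem_biUnion.2 ⟨e, he, Sym2.mem_toFinset.2 hx⟩
  have hedge : ∀ u ∈ U, ∀ v ∈ U, ∀ h : G.Adj u v, f.symm ⟨s(u, v), h⟩ ∈ S := by
    intro u hu v hv h
    refine hS.2 _ fun x hx => ?_
    dsimp only at hx
    rw [Equiv.apply_symm_apply, Sym2.mem_toFinset, Sym2.mem_iff] at hx
    rcases hx with rfl | rfl
    · exact hu
    · exact hv
  refine ⟨(⊤ : G.Subgraph).induce U, ?_, ?_, ?_⟩
  · exact fun _ hu _ hv h => ⟨hu, hv, h⟩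
  · intro u hu
    obtain ⟨e, he, hue⟩ := Finset.mem_biUnion.1 (show u ∈ U from hu)
    obtain ⟨w, hw⟩ := Sym2.mem_toFinset.1 hue
    have hadj : G.Adj u w := by
      have h := (f e).2
      rw [hw] at h
      exact h
    refine ⟨w, ⟨hu, hmemU e he w (hw ▸ Sym2.mem_mk_right u w), hadj⟩, ?_⟩
    rintro w' ⟨-, hw', h'⟩
    have h' : G.Adj u w' := h'
    by_contra hne
    have he' := hedge u hu w' hw' h'
    have hne' : f.symm ⟨s(u, w'), h'⟩ ≠ e := by
      rintro rfl
      rw [Equiv.apply_symm_apply] at hw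
      exact hne (Sym2.congr_right.1 hw)
    refine Finset.disjoint_left.1 (disjoint_of_card_biUnion (card_toFinset_edge f) hS.1 he) hue
      (Finset.mem_biUnion.2 ⟨_, Finset.mem_erase.2 ⟨hne', he'⟩, ?_⟩)
    rw [Equiv.apply_symm_apply, Sym2.mem_toFinset]
    exact Sym2.mem_mk_left u w'
  · ext e
    rw [mem_edgeIndices]
    obtain ⟨⟨u, v⟩, hx⟩ := (f e).1.exists_rep
    have huv := (f e).2
    rw [← hx] at huv
    have hfe : f.symm ⟨s(u, v), huv⟩ = e := by
      rw [Equiv.symm_apply_eq]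
      exact Subtype.ext hx
    constructor
    · intro h
      rw [← hx] at h
      obtain ⟨hu, hv, -⟩ := h
      rw [← hfe]
      exact hedge u hu v hv huv
    · intro h
      have hm := hmemU e h
      rw [← hx] at hm ⊢
      exact ⟨hm u (Sym2.mem_mk_left u v), hm v (Sym2.mem_mk_right u v), huv⟩

open Classical in
theorem ncard_inducedDisjointEdges (i : ℕ) : (G.inducedDisjointEdges i).ncard =
    (Finset.univ.filter fun S : Finset E =>
      S.card = i ∧ IsInducedMatching (fun e => (f e).1.toFinset) S).card := by
  rw [← Set.ncard_coe_finset]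
  refine Set.ncard_congr (fun H _ => edgeIndices f H) ?_ ?_ ?_
  · rintro H ⟨h1, h2, h3⟩
    simp only [Finset.coe_filter, Finset.mem_univ, true_and, Set.mem_ofPred_eq]
    exact ⟨(card_edgeIndices f H).trans h3, isInducedMatching_edgeIndices f h1 h2⟩
  · intro H H' h h' heq
    refine SimpleGraph.Subgraph.IsMatching.injOn_edgeSet h.2.1 h'.2.1 ?_
    rw [← image_edgeIndices f H, heq, image_edgeIndices]
  · intro S hS
    simp only [Finset.coe_filter, Finset.mem_univ, true_and, Set.mem_ofPred_eq] at hS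
    obtain ⟨H, h1, h2, rfl⟩ := exists_edgeIndices_eq f hS.2
    exact ⟨H, ⟨h1, h2, (card_edgeIndices f H).symm.trans hS.1⟩, rfl⟩

end EdgeIdeal

theorem mainTheorem8 (K : Type*) [Field K] {V : Type*} [Finite V] (G : SimpleGraph V)
    (i : ℕ) (hi : 1 ≤ i) :
    Nonempty (GradedMinimalFreeResolution (G.edgeIdeal K)) ∧
      ∀ F : GradedMinimalFreeResolution (G.edgeIdeal K),
        (∀ d : ℤ, 2 * (i : ℤ) < d → F.betti i d = 0) ∧
          F.betti i (2 * (i : ℤ)) = (G.inducedDisjointEdges i).ncard := by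
  classical
  have f : Fin (Nat.card G.edgeSet) ≃ G.edgeSet := (Finite.equivFin G.edgeSet).symm
  have hI := edgeIdeal_eq_span_squarefreeExponent K G f
  have hmem : ∀ p, p ∈ G.edgeIdeal K ↔
      ∀ w, coeff w p ≠ 0 → ∃ e, squarefreeExponent (f e).1.toFinset ≤ w := by
    intro p
    rw [hI, mem_span_range_monomial_iff]
  refine ⟨nonempty_gradedMinimalFreeResolution (fun e p hp => ?_) (fun p hp => ?_)
    (taylorResolution _ hI) ⟨Nat.card G.edgeSet, fun j hj => ⟨fun S => ?_⟩⟩, fun F => ?_⟩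
  · rw [hmem] at hp ⊢
    intro w hw
    rw [coeff_intComponent] at hw
    exact hp w fun h => hw (by rw [h, ite_self])
  · by_contra h
    obtain ⟨e, he⟩ := (hmem p).1 hp 0 (by rwa [← constantCoeff_eq])
    have h1 := Finsupp.degree_mono he
    rw [degree_squarefreeExponent, card_toFinset_edge, map_zero] at h1
    omega
  · have h := Finset.card_le_univ S.1
    rw [S.2, Fintype.card_fin] at h
    omega
  · obtain ⟨j, rfl⟩ : ∃ j, i = j + 1 := ⟨i - 1, by omega⟩
    refine ⟨fun d hd => ?_, ?_⟩
    · refine Finset.card_eq_zero.2 (Finset.filter_eq_empty_iff.2 fun a _ h => ?_)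
      have := F.isMinimal.deg_le_two_mul (card_toFinset_edge f) hI j a
      exact absurd (h ▸ this) hd.not_ge
    · rw [ncard_inducedDisjointEdges f, ← F.isMinimal.card_deg_eq_two_mul (card_toFinset_edge f)
        (toFinset_edge_injective f) hI j, GradedMinimalFreeResolution.betti]
      rfl
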